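/- \textbf{Proposition (Characterisation of blow-ups).} Let $n\ge 1$ and $\alpha\in(0,1)$. For $\varphi\in C^\infty_c(\mathbb{R}^n;\mathbb{R}^n)$ let $$\operatorname{div}^\alpha\varphi(x)=\mu_{n,\alpha}\lim_{\varepsilon\to0^+}\int_{\{|z|>\varepsilon\}}\frac{z\cdot\varphi(x+z)}{|z|^{n+\alpha+1}}\,dz,\qquad \mu_{n,\alpha}=2^\alpha\pi^{-n/2}\,\frac{\Gamma\left(\frac{n+\alpha+1}{2}\right)}{\Gamma\left(\frac{1-\alpha}{2}\right)}.$$ A Lebesgue measurable set $E\subset\mathbb{R}^n$ has \emph{locally finite fractional Caccioppoli $\alpha$-perimeter} in $\mathbb{R}^n$ if for every bounded open set $U\subset\mathbb{R}^n$ $$\sup\left\{\int_E\operatorname{div}^\alpha\varphi\,dx:\ \varphi\in C^\infty_c(U;\mathbb{R}^n),\ \|\varphi\|_{L^\infty}\le1\right\}<+\infty .$$ In this case $D^\alpha\chi_E$ denotes the (unique) $\mathbb{R}^n$-valued Radon measure on $\mathbb{R}^n$ such that $\int_E\operatorname{div}^\alpha\varphi\,dx=-\int_{\mathbb{R}^n}\varphi\cdot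 dD^\alpha\chi_E$ for all $\varphi\in C^\infty_c(\mathbb{R}^n;\mathbb{R}^n)$, and $|D^\alpha\chi_E|$ denotes its total variation measure. The \emph{fractional reduced boundary} $\partial^{*,\alpha}E$ is the set of all $x\in\operatorname{supp}(D^\alpha\chi_E)$ for which the limit $$\nu^\alpha_E(x):=\lim_{r\to0^+}\frac{D^\alpha\chi_E(B_r(x))}{|D^\alpha\chi_E|(B_r(x))}$$ exists and has norm $1$. For $x\in\mathbb{R}^n$, $\operatorname{Tan}(E,x)$ is the set of all measurable $F\subset\mathbb{R}^n$ such that $\chi_{(E-x)/r_k}\to\chi_F$ in $L^1_{\mathrm{loc}}(\mathbb{R}^n)$ for some sequence $r_k>0$ with $r_k\to0$. Let $E\subset\mathbb{R}^n$ be a set with locally finite fractional Caccioppoli $\alpha$-perimeter in $\mathbb{R}^n$, let $x\in\partial^{*,\alpha}E$ and let $F\in\operatorname{Tan}(E,x)$. Then $F$ has locally finite fractional Caccioppoli $\alpha$-perimeter in $\mathbb{R}^n$ (so that the Radon measure $D^\alpha\chi_F$ exists), and $$\nu^\alpha_F(y)=\nu^\alpha_E(x)\qquad\text{for }|D^\alpha\chi_F|\text{-a.e.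 }y\in\partial^{*,\alpha}F .$$ -/

import Mathlib

open MeasureTheory Set Filter Topology
open scoped ContDiff

namespace FracBV

noncomputable section

/-- `ℝⁿ` with its Euclidean norm. -/
abbrev Rn (n : ℕ) : Type := EuclideanSpace ℝ (Fin n)

/-- The constant `2 ^ α * π ^ (-n / 2) * Γ ((n + α + 1) / 2) / Γ ((1 - α) / 2)`. -/
def mu (n : ℕ) (α : ℝ) : ℝ :=
  2 ^ α * Real.pi ^ (-(n : ℝ) / 2) *
    (Real.Gamma (((n : ℝ) + α + 1) / 2) / Real.Gamma ((1 - α) / 2))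

/-- The fractional `α`-divergence of a vector field, as a principal value. -/
def fracDiv {n : ℕ} (α : ℝ) (φ : Rn n → Rn n) (x : Rn n) : ℝ :=
  mu n α * limUnder (𝓝[>] (0 : ℝ)) (fun ε : ℝ =>
    ∫ z in {z : Rn n | ε < ‖z‖}, inner ℝ z (φ (x + z)) / ‖z‖ ^ ((n : ℝ) + α + 1))

/-- `φ ∈ C_c^∞(Ω; ℝⁿ)`: a smooth field on `ℝⁿ` with compact support contained in `Ω`. -/
structure IsTestField {n : ℕ} (Ω : Set (Rn n)) (φ : Rn n → Rn n) : Prop where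
  smooth : ContDiff ℝ ∞ φ
  compactSupport : HasCompactSupport φ
  support_subset : tsupport φ ⊆ Ω

/-- The fractional Caccioppoli `α`-perimeter of `E` in the open set `Ω`: the supremum of
`∫_E div^α φ` over test fields `φ` in `Ω` with `‖φ‖_∞ ≤ 1`.
Since `φ = 0` is admissible, truncating negative values at `0` does not change the supremum. -/
def fracPerimeter {n : ℕ} (α : ℝ) (E Ω : Set (Rn n)) : ENNReal :=
  ⨆ (φ : Rn n → Rn n) (_ : IsTestField Ω φ) (_ : ∀ x, ‖φ x‖ ≤ 1),
    ENNReal.ofReal (∫ y in E, fracDiv α φ y)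

/-- `E` is a (Lebesgue measurable) set with locally finite fractional Caccioppoli
`α`-perimeter in `Ω`: the perimeter is finite in every open `U` compactly contained in `Ω`. -/
def HasLocFiniteFracPerimeter {n : ℕ} (α : ℝ) (E Ω : Set (Rn n)) : Prop :=
  NullMeasurableSet E (volume : Measure (Rn n)) ∧
    ∀ U : Set (Rn n), IsOpen U → IsCompact (closure U) → closure U ⊆ Ω →
      fracPerimeter α E U < ⊤

/-- The pair `(m, σ)` is a polar decomposition `D^α χ_E = σ m` of the fractional gradient of
`χ_E`: `m` is a (nonnegative) Radon measure on `ℝⁿ`, `|σ| = 1` `m`-a.e., and the Gauss–Green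
formula holds. Thus `m = |D^α χ_E|`, and `D^α χ_E (B) = ∫_B σ dm` for bounded Borel sets `B`. -/
structure IsFracGradient {n : ℕ} (α : ℝ) (E : Set (Rn n)) (m : Measure (Rn n))
    (σ : Rn n → Rn n) : Prop where
  locallyFinite : IsLocallyFiniteMeasure m
  measurable : Measurable σ
  norm_eq_one : ∀ᵐ y ∂m, ‖σ y‖ = 1
  gaussGreen : ∀ φ : Rn n → Rn n, IsTestField univ φ →
    ∫ y in E, fracDiv α φ y = -∫ y, inner ℝ (φ y) (σ y) ∂m

open Classical in
/-- The polar decomposition of `D^α χ_E` (unique, up to changing the density on a null set,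
whenever it exists; it exists if `E` has locally finite fractional Caccioppoli `α`-perimeter). -/
def fracGradient {n : ℕ} (α : ℝ) (E : Set (Rn n)) : Measure (Rn n) × (Rn n → Rn n) :=
  if h : ∃ p : Measure (Rn n) × (Rn n → Rn n), IsFracGradient α E p.1 p.2 then h.choose
  else (0, 0)

/-- The fractional variation measure `|D^α χ_E|`. -/
def fracVariation {n : ℕ} (α : ℝ) (E : Set (Rn n)) : Measure (Rn n) :=
  (fracGradient α E).1

/-- The density of `D^α χ_E` with respect to `|D^α χ_E|`. -/
def fracDensity {n : ℕ} (α : ℝ) (E : Set (Rn n)) : Rn n → Rn n :=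
  (fracGradient α E).2

/-- The value `D^α χ_E (B) ∈ ℝⁿ` of the vector measure on a bounded Borel set `B`. -/
def fracGradientValue {n : ℕ} (α : ℝ) (E B : Set (Rn n)) : Rn n :=
  ∫ y in B, fracDensity α E y ∂(fracVariation α E)

/-- The quotient `D^α χ_E (B_r(x)) / |D^α χ_E| (B_r(x))`. -/
def normalQuotient {n : ℕ} (α : ℝ) (E : Set (Rn n)) (x : Rn n) (r : ℝ) : Rn n :=
  ((fracVariation α E).real (Metric.ball x r))⁻¹ • fracGradientValue α E (Metric.ball x r)

/-- The fractional reduced boundary of `E` (in `ℝⁿ`). -/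
def fracReducedBoundary {n : ℕ} (α : ℝ) (E : Set (Rn n)) : Set (Rn n) :=
  {x | x ∈ (fracVariation α E).support ∧
    ∃ v : Rn n, ‖v‖ = 1 ∧ Tendsto (normalQuotient α E x) (𝓝[>] (0 : ℝ)) (𝓝 v)}

/-- The inner unit fractional normal `ν_E^α`, meaningful on the fractional reduced boundary. -/
def fracNormal {n : ℕ} (α : ℝ) (E : Set (Rn n)) (x : Rn n) : Rn n :=
  limUnder (𝓝[>] (0 : ℝ)) (normalQuotient α E x)

/-- The rescaled set `(E - x) / r`, for `r > 0`. -/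
def rescaled {n : ℕ} (E : Set (Rn n)) (x : Rn n) (r : ℝ) : Set (Rn n) :=
  {y | x + r • y ∈ E}

/-- Convergence `χ_{A k} → χ_F` in `L¹_loc(ℝⁿ)`. -/
def TendstoL1Loc {n : ℕ} (A : ℕ → Set (Rn n)) (F : Set (Rn n)) : Prop :=
  ∀ K : Set (Rn n), IsCompact K →
    Tendsto (fun k => eLpNorm ((A k).indicator (fun _ => (1 : ℝ)) - F.indicator (fun _ => (1 : ℝ)))
      1 (volume.restrict K)) atTop (𝓝 0)

/-- The tangent sets of `E` at `x`: all limit points in `L¹_loc` of `(E - x) / r` as `r → 0`. -/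
def Tan {n : ℕ} (E : Set (Rn n)) (x : Rn n) : Set (Set (Rn n)) :=
  {F | NullMeasurableSet F (volume : Measure (Rn n)) ∧
    ∃ r : ℕ → ℝ, (∀ k, 0 < r k) ∧ Tendsto r atTop (𝓝 0) ∧
      TendstoL1Loc (fun k => rescaled E x (r k)) F}

end

end FracBV

/-!
The blow-up of `D^α χ_E` at a point `x` of the fractional reduced boundary has a constant direction,
namely the normal `v` of `E` at `x`, and it passes to the limit along the sets `(E - x) / r_k`.

The integral defining `div^α φ` is absolutely convergent once `φ (x + z)` is replaced by
`φ (x + z) - φ x` (`fracDiv_eq`), so that `div^α φ` is bounded and integrable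
(`exists_abs_fracDiv_le`, `integrable_fracDiv`). By homogeneity, `D^α χ_{(E - x) / r}` is the image
of `D^α χ_E` under `u ↦ (u - x) / r`, times `r ^ (α - n)` (`IsFracGradient.rescaled`).

At `x` the averages of the density `σ` over `B_r(x)` tend to `v`. Since `|σ| = 1 = |v|`, this means
that `∫_{B_r(x)} (1 - ⟨v, σ⟩) d|D^α χ_E|` is small compared with `|D^α χ_E| (B_r(x))`. Testing
Gauss–Green with a cut-off of the constant field `v` at scale `r` gives
`|D^α χ_E| (B_r(x)) ≤ C r ^ (n - α) + ε |D^α χ_E| (B_{2r}(x))` with `ε` as small as desired, and a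
dyadic iteration absorbs the last term
(`IsFracGradient.exists_rpow_mul_measureReal_ball_le`). Hence the rescaled variations are locally
bounded and their densities converge to `v` in the mean.

By `L¹_loc` convergence, `∫_{E_k} div^α φ → ∫_F div^α φ`, and so the rescaled variations converge
when tested against smooth functions, thus vaguely, to a measure `μ` with `D^α χ_F = v μ`
(`exists_isFracGradient_const_of_tendsto`). The polar decomposition of a vector measure being
unique (`IsFracGradient.ae_eq_of_const`), the density of `D^α χ_F` is `v` almost everywhere, and
then all the quotients `D^α χ_F (B_r(y)) / |D^α χ_F| (B_r(y))` are equal to `v`.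
-/

namespace FracBV

/-! ### Integrability of the fractional divergence -/

/-- The weight `min 1 ‖z‖ / ‖z‖ ^ (n + α)`, an integrable majorant (up to a constant) of the
integrand of the fractional divergence of a test field. -/
noncomputable def weight (n : ℕ) (α : ℝ) (z : Rn n) : ℝ :=
  min 1 ‖z‖ * ‖z‖ ^ (-((n : ℝ) + α))

theorem weight_nonneg (n : ℕ) (α : ℝ) (z : Rn n) : 0 ≤ weight n α z := by
  unfold weight; positivity

theorem measurable_weight (n : ℕ) (α : ℝ) : Measurable (weight n α) := by
  unfold weight; fun_prop

theorem integrable_weight {n : ℕ} (hn : 0 < n) {α : ℝ} (hα0 : 0 < α) (hα1 : α < 1) :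
    Integrable (weight n α) := by
  have hfin : Module.finrank ℝ (Rn n) = n := by simp
  have hball : IntegrableOn (weight n α) (Metric.ball 0 1) := by
    refine integrableOn_ball_of_norm_le_rpow (C := 1) (α := (n : ℝ) + α - 1)
      (by rw [hfin]; exact hn) (by rw [hfin]; linarith) (ae_of_all _ fun z => ?_)
      (measurable_weight n α).aestronglyMeasurable
    rw [Real.norm_of_nonneg (weight_nonneg n α z), one_mul]
    rcases eq_or_ne z 0 with rfl | hz
    · simp only [weight, norm_zero]; simp only [zero_le_one, inf_of_le_right, zero_mul]; positivity
    have hz' : 0 < ‖z‖ := norm_pos_iff.2 hz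
    calc weight n α z ≤ ‖z‖ * ‖z‖ ^ (-((n : ℝ) + α)) := by
          unfold weight; gcongr; exact min_le_right _ _
      _ = ‖z‖ ^ (-((n : ℝ) + α - 1)) := by
          rw [show -((n : ℝ) + α - 1) = 1 + -((n : ℝ) + α) by ring, Real.rpow_add hz',
            Real.rpow_one]
  have hcompl : IntegrableOn (weight n α) (Metric.ball 0 1)ᶜ := by
    have h1 : Integrable (fun z : Rn n => (1 + ‖z‖) ^ (-((n : ℝ) + α))) :=
      integrable_one_add_norm (by rw [hfin]; linarith)
    refine Integrable.mono' ((h1.const_mul (2 ^ ((n : ℝ) + α))).integrableOn)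
      (measurable_weight n α).aestronglyMeasurable ?_
    refine (ae_restrict_iff' Metric.isOpen_ball.measurableSet.compl).2 (ae_of_all _ fun z hz => ?_)
    have hz1 : 1 ≤ ‖z‖ := by simpa using hz
    rw [Real.norm_of_nonneg (weight_nonneg n α z)]
    have hp : 0 ≤ (n : ℝ) + α := by positivity
    calc weight n α z ≤ 1 * ‖z‖ ^ (-((n : ℝ) + α)) := by
          unfold weight; gcongr; exact min_le_left _ _
      _ = 2 ^ ((n : ℝ) + α) * (2 * ‖z‖) ^ (-((n : ℝ) + α)) := by
          rw [Real.mul_rpow (by norm_num) (by positivity), ← mul_assoc,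
            ← Real.rpow_add (by norm_num)]
          simp
      _ ≤ _ := by
          gcongr 2 ^ ((n : ℝ) + α) * ?_
          exact Real.rpow_le_rpow_of_nonpos (by positivity) (by linarith) (by linarith)
  rw [← integrableOn_univ, ← union_compl_self (Metric.ball (0 : Rn n) 1)]
  exact hball.union hcompl

/-- A test field is Lipschitz and bounded, and its increments vanish unless one of the end points
lies in the support. The resulting bound is integrable in `x` as well as against `weight` in `z`. -/
theorem IsTestField.exists_increment_bound {n : ℕ} {Ω : Set (Rn n)} {φ : Rn n → Rn n}
    (hφ : IsTestField Ω φ) :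
    ∃ A : ℝ, 0 ≤ A ∧ ∀ x z, ‖φ (x + z) - φ x‖ ≤
      A * min 1 ‖z‖ * ((tsupport φ).indicator 1 x + (tsupport φ).indicator 1 (x + z)) := by
  have hφ1 : ContDiff ℝ 1 φ := hφ.smooth.of_le (by simp)
  obtain ⟨L, hL⟩ := hφ1.lipschitzWith_of_hasCompactSupport hφ.compactSupport (by simp)
  obtain ⟨M, hM⟩ := hφ.compactSupport.exists_bound_of_continuous hφ.smooth.continuous
  have hM0 : 0 ≤ M := (norm_nonneg _).trans (hM 0)
  refine ⟨max L (2 * M), by positivity, fun x z => ?_⟩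
  have key : ‖φ (x + z) - φ x‖ ≤ max (L : ℝ) (2 * M) * min 1 ‖z‖ := by
    rcases le_total 1 ‖z‖ with h | h
    · rw [min_eq_left h, mul_one]
      refine le_trans ?_ (le_max_right _ _)
      linarith [norm_sub_le (φ (x + z)) (φ x), hM x, hM (x + z)]
    · rw [min_eq_right h]
      have := hL.norm_sub_le (x + z) x
      rw [add_sub_cancel_left] at this
      exact this.trans (by gcongr; exact le_max_left _ _)
  have hpos : 0 ≤ max (L : ℝ) (2 * M) * min 1 ‖z‖ := (norm_nonneg _).trans key
  by_cases hx : x ∈ tsupport φ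
  · refine key.trans (le_mul_of_one_le_right hpos ?_)
    rw [indicator_of_mem hx]
    have : (0 : ℝ) ≤ (tsupport φ).indicator 1 (x + z) := indicator_nonneg (by simp) _
    simpa using this
  · by_cases hxz : x + z ∈ tsupport φ
    · refine key.trans (le_mul_of_one_le_right hpos ?_)
      simp [hx, hxz]
    · simp [hx, hxz, image_eq_zero_of_notMem_tsupport]

/-- The integrand of the fractional divergence, with the cancellation `∫ z / ‖z‖ ^ (n + α + 1) = 0`
built in. -/
noncomputable def divKernel {n : ℕ} (α : ℝ) (φ : Rn n → Rn n) (x z : Rn n) : ℝ :=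
  inner ℝ z (φ (x + z) - φ x) / ‖z‖ ^ ((n : ℝ) + α + 1)

theorem abs_inner_div_rpow_le {n : ℕ} (α : ℝ) (z v : Rn n) :
    |inner ℝ z v / ‖z‖ ^ ((n : ℝ) + α + 1)| ≤ ‖v‖ * ‖z‖ ^ (-((n : ℝ) + α)) := by
  rcases eq_or_ne z 0 with rfl | hz
  · simp; positivity
  have hz' : 0 < ‖z‖ := norm_pos_iff.2 hz
  rw [abs_div, abs_of_nonneg (by positivity : 0 ≤ ‖z‖ ^ ((n : ℝ) + α + 1)),
    div_le_iff₀ (by positivity), mul_assoc, ← Real.rpow_add hz']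
  refine (abs_real_inner_le_norm z v).trans ?_
  rw [show -((n : ℝ) + α) + ((n : ℝ) + α + 1) = 1 by ring, Real.rpow_one, mul_comm]

theorem abs_divKernel_le {n : ℕ} (α : ℝ) {φ : Rn n → Rn n} {S : Set (Rn n)} {A : ℝ}
    (hA : ∀ x z, ‖φ (x + z) - φ x‖ ≤ A * min 1 ‖z‖ * (S.indicator 1 x + S.indicator 1 (x + z)))
    (x z : Rn n) :
    |divKernel α φ x z| ≤ A * ((S.indicator 1 x + S.indicator 1 (x + z)) * weight n α z) := by
  refine (abs_inner_div_rpow_le α z _).trans ?_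
  unfold weight
  have := mul_le_mul_of_nonneg_right (hA x z) (by positivity : 0 ≤ ‖z‖ ^ (-((n : ℝ) + α)))
  refine this.trans (le_of_eq (by ring))

theorem measurable_divKernel {n : ℕ} (α : ℝ) {φ : Rn n → Rn n} (hφ : Continuous φ) :
    Measurable (Function.uncurry (divKernel α φ)) := by
  unfold divKernel Function.uncurry
  have := hφ.measurable
  fun_prop

theorem integrable_divKernel {n : ℕ} (hn : 0 < n) {α : ℝ} (hα0 : 0 < α) (hα1 : α < 1)
    {Ω : Set (Rn n)} {φ : Rn n → Rn n} (hφ : IsTestField Ω φ) :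
    Integrable (Function.uncurry (divKernel α φ)) (volume.prod volume) := by
  obtain ⟨A, -, hA⟩ := hφ.exists_increment_bound
  have hS : MeasurableSet (tsupport φ) := (isClosed_tsupport φ).measurableSet
  have h1 : Integrable ((tsupport φ).indicator (1 : Rn n → ℝ)) :=
    (integrable_indicator_iff hS).2 (integrableOn_const hφ.compactSupport.measure_lt_top.ne)
  have h2 : Integrable (fun p : Rn n × Rn n => (tsupport φ).indicator (1 : Rn n → ℝ) p.1 *
      weight n α p.2)
      (volume.prod volume) := h1.mul_prod (integrable_weight hn hα0 hα1)
  have h3 : Integrable (fun p : Rn n × Rn n => (tsupport φ).indicator (1 : Rn n → ℝ) (p.1 + p.2) *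
      weight n α p.2) (volume.prod volume) := by
    have hmp : MeasurePreserving (fun p : Rn n × Rn n => (p.1 + p.2, p.2))
      (volume.prod volume) (volume.prod volume) := measurePreserving_add_prod _ _
    exact hmp.integrable_comp_of_integrable h2
  refine Integrable.mono' ((h2.add h3).const_mul A)
    (measurable_divKernel α hφ.smooth.continuous).aestronglyMeasurable (ae_of_all _ fun p => ?_)
  refine (abs_divKernel_le α hA p.1 p.2).trans (le_of_eq ?_)
  simp only [Pi.add_apply]; ring

theorem abs_divKernel_le_weight {n : ℕ} (α : ℝ)
    {Ω : Set (Rn n)} {φ : Rn n → Rn n} (hφ : IsTestField Ω φ) :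
    ∃ A : ℝ, ∀ x z, |divKernel α φ x z| ≤ A * weight n α z := by
  obtain ⟨A, hA0, hA⟩ := hφ.exists_increment_bound
  refine ⟨A * 2, fun x z => (abs_divKernel_le α hA x z).trans ?_⟩
  rw [mul_assoc]
  have h1 : ∀ y, (tsupport φ).indicator (1 : Rn n → ℝ) y ≤ 1 := fun y =>
    indicator_le_self' (by simp) y
  have := weight_nonneg n α z
  gcongr
  linarith [h1 x, h1 (x + z)]

/-- The integrand is odd. -/
theorem setIntegral_inner_div_eq_zero {n : ℕ} (p ε : ℝ) (v : Rn n) :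
    ∫ z in {z : Rn n | ε < ‖z‖}, inner ℝ z v / ‖z‖ ^ p = 0 := by
  rw [← integral_indicator (measurableSet_lt measurable_const measurable_norm)]
  have h := integral_neg_eq_self ({z : Rn n | ε < ‖z‖}.indicator fun z => inner ℝ z v / ‖z‖ ^ p)
    (volume : Measure (Rn n))
  have h2 : ∀ z : Rn n, ({z : Rn n | ε < ‖z‖}.indicator fun z => inner ℝ z v / ‖z‖ ^ p) (-z) =
      -({z : Rn n | ε < ‖z‖}.indicator fun z => inner ℝ z v / ‖z‖ ^ p) z := by
    intro z
    by_cases hz : ε < ‖z‖ <;> simp [indicator, hz, neg_div]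
  simp_rw [h2, integral_neg] at h
  linarith

theorem measurableSet_lt_norm {n : ℕ} (ε : ℝ) : MeasurableSet {z : Rn n | ε < ‖z‖} :=
  measurableSet_lt measurable_const measurable_norm

theorem integrable_divKernel_right {n : ℕ} (hn : 0 < n) {α : ℝ} (hα0 : 0 < α) (hα1 : α < 1)
    {Ω : Set (Rn n)} {φ : Rn n → Rn n} (hφ : IsTestField Ω φ) (x : Rn n) :
    Integrable (divKernel α φ x) := by
  obtain ⟨A, hA⟩ := abs_divKernel_le_weight α hφ
  exact ((integrable_weight hn hα0 hα1).const_mul A).mono'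
    ((measurable_divKernel α hφ.smooth.continuous).comp
      measurable_prodMk_left).aestronglyMeasurable (ae_of_all _ (hA x))

theorem integrableOn_inner_div {n : ℕ} (hn : 0 < n) {α : ℝ} (hα0 : 0 < α) (hα1 : α < 1)
    {ε : ℝ} (hε : 0 < ε) (v : Rn n) :
    IntegrableOn (fun z : Rn n => inner ℝ z v / ‖z‖ ^ ((n : ℝ) + α + 1))
        {z : Rn n | ε < ‖z‖} := by
  refine Integrable.mono'
    ((integrable_weight hn hα0 hα1).const_mul (‖v‖ * (min 1 ε)⁻¹)).integrableOn
    (Measurable.aestronglyMeasurable (by fun_prop)) ?_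
  refine (ae_restrict_iff' (measurableSet_lt_norm ε)).2 (ae_of_all _ fun z (hz : ε < ‖z‖) => ?_)
  refine (abs_inner_div_rpow_le α z _).trans ?_
  unfold weight
  have h1 : 1 ≤ (min 1 ε)⁻¹ * min 1 ‖z‖ := by
    rw [inv_mul_eq_div, one_le_div (by positivity)]
    gcongr
  have h2 : 0 ≤ ‖v‖ * ‖z‖ ^ (-((n : ℝ) + α)) := by positivity
  calc _ ≤ ‖v‖ * ‖z‖ ^ (-((n : ℝ) + α)) * ((min 1 ε)⁻¹ * min 1 ‖z‖) :=
        le_mul_of_one_le_right h2 h1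
    _ = _ := by ring

theorem setIntegral_truncated_eq {n : ℕ} (hn : 0 < n) {α : ℝ} (hα0 : 0 < α) (hα1 : α < 1)
    {Ω : Set (Rn n)} {φ : Rn n → Rn n} (hφ : IsTestField Ω φ) (x : Rn n) {ε : ℝ} (hε : 0 < ε) :
    ∫ z in {z : Rn n | ε < ‖z‖}, inner ℝ z (φ (x + z)) / ‖z‖ ^ ((n : ℝ) + α + 1) =
      ∫ z in {z : Rn n | ε < ‖z‖}, divKernel α φ x z := by
  rw [← add_zero (∫ z in _, divKernel α φ x z),
    ← setIntegral_inner_div_eq_zero ((n : ℝ) + α + 1) ε (φ x),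
    ← integral_add (integrable_divKernel_right hn hα0 hα1 hφ x).integrableOn
      (integrableOn_inner_div hn hα0 hα1 hε (φ x))]
  congr 1 with z
  simp only [divKernel]
  rw [inner_sub_right]; ring

theorem tendsto_truncated {n : ℕ} (hn : 0 < n) {α : ℝ} (hα0 : 0 < α) (hα1 : α < 1)
    {Ω : Set (Rn n)} {φ : Rn n → Rn n} (hφ : IsTestField Ω φ) (x : Rn n) :
    Tendsto (fun ε : ℝ => ∫ z in {z : Rn n | ε < ‖z‖},
      inner ℝ z (φ (x + z)) / ‖z‖ ^ ((n : ℝ) + α + 1)) (𝓝[>] 0) (𝓝 (∫ z, divKernel α φ x z)) := by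
  have hint := integrable_divKernel_right hn hα0 hα1 hφ x
  have hlim : Tendsto (fun ε : ℝ => ∫ z, {z : Rn n | ε < ‖z‖}.indicator (divKernel α φ x) z)
      (𝓝[>] 0) (𝓝 (∫ z, divKernel α φ x z)) := by
    refine tendsto_integral_filter_of_dominated_convergence (fun z => ‖divKernel α φ x z‖)
      (Eventually.of_forall fun ε =>
        (hint.indicator (measurableSet_lt_norm ε)).aestronglyMeasurable)
      (Eventually.of_forall fun ε => ae_of_all _ fun z =>
        norm_indicator_le_norm_self _ _) hint.norm (ae_of_all _ fun z => ?_)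
    rcases eq_or_ne z 0 with rfl | hz
    · have : divKernel α φ x 0 = 0 := by simp [divKernel]
      simp [indicator, this]
    · refine tendsto_const_nhds.congr' ?_
      have : ∀ᶠ ε : ℝ in 𝓝[>] 0, ε < ‖z‖ :=
        nhdsWithin_le_nhds (eventually_lt_nhds (norm_pos_iff.2 hz))
      filter_upwards [this] with ε hε
      rw [indicator_of_mem (by exact hε)]
  refine hlim.congr' ?_
  filter_upwards [self_mem_nhdsWithin] with ε hε
  rw [setIntegral_truncated_eq hn hα0 hα1 hφ x hε, integral_indicator (measurableSet_lt_norm ε)]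

/-- The principal value defining `div^α φ` converges, to an absolutely convergent integral. -/
theorem fracDiv_eq {n : ℕ} (hn : 0 < n) {α : ℝ} (hα0 : 0 < α) (hα1 : α < 1)
    {Ω : Set (Rn n)} {φ : Rn n → Rn n} (hφ : IsTestField Ω φ) (x : Rn n) :
    fracDiv α φ x = mu n α * ∫ z, divKernel α φ x z := by
  rw [fracDiv, (tendsto_truncated hn hα0 hα1 hφ x).limUnder_eq]

theorem integrable_fracDiv {n : ℕ} (hn : 0 < n) {α : ℝ} (hα0 : 0 < α) (hα1 : α < 1)
    {Ω : Set (Rn n)} {φ : Rn n → Rn n} (hφ : IsTestField Ω φ) : Integrable (fracDiv α φ) := by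
  rw [funext (fracDiv_eq hn hα0 hα1 hφ)]
  exact ((integrable_divKernel hn hα0 hα1 hφ).integral_prod_left).const_mul _

theorem exists_abs_fracDiv_le {n : ℕ} (hn : 0 < n) {α : ℝ} (hα0 : 0 < α) (hα1 : α < 1)
    {Ω : Set (Rn n)} {φ : Rn n → Rn n} (hφ : IsTestField Ω φ) :
    ∃ C : ℝ, ∀ x, |fracDiv α φ x| ≤ C := by
  obtain ⟨A, hA⟩ := abs_divKernel_le_weight α hφ
  have hw := integrable_weight hn hα0 hα1
  have key : ∀ x, |fracDiv α φ x| ≤ |mu n α| * ∫ z, A * weight n α z := by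
    intro x
    rw [fracDiv_eq hn hα0 hα1 hφ, abs_mul]
    gcongr
    exact norm_integral_le_of_norm_le (hw.const_mul A)
      (ae_of_all _ fun z => (Real.norm_eq_abs _).trans_le (hA x z))
  exact ⟨_, key⟩

/-! ### Scaling of the fractional gradient -/

theorem IsTestField.comp_dilation {n : ℕ} {φ : Rn n → Rn n} (hφ : IsTestField univ φ)
    (x : Rn n) {r : ℝ} (hr : 0 < r) : IsTestField univ (fun u => φ (r⁻¹ • (u - x))) := by
  refine ⟨hφ.smooth.comp (by fun_prop), ?_, subset_univ _⟩
  exact hφ.compactSupport.comp_homeomorph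
    ((Homeomorph.subRight x).trans (Homeomorph.smulOfNeZero r⁻¹ (inv_ne_zero hr.ne')))

/-- The fractional divergence is homogeneous of degree `-α`. -/
theorem fracDiv_comp_dilation {n : ℕ} (hn : 0 < n) {α : ℝ} (hα0 : 0 < α) (hα1 : α < 1)
    {φ : Rn n → Rn n} (hφ : IsTestField univ φ) (x : Rn n) {r : ℝ} (hr : 0 < r) (u : Rn n) :
    fracDiv α (fun u => φ (r⁻¹ • (u - x))) u = r ^ (-α) * fracDiv α φ (r⁻¹ • (u - x)) := by
  rw [fracDiv_eq hn hα0 hα1 (hφ.comp_dilation x hr), fracDiv_eq hn hα0 hα1 hφ]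
  have h1 : ∀ w, divKernel α (fun u => φ (r⁻¹ • (u - x))) u (r • w) =
      r ^ (-((n : ℝ) + α)) * divKernel α φ (r⁻¹ • (u - x)) w := by
    intro w
    simp only [divKernel]
    have h2 : r⁻¹ • (u + r • w - x) = r⁻¹ • (u - x) + w := by
      rw [show u + r • w - x = (u - x) + r • w by abel, smul_add, smul_smul,
        inv_mul_cancel₀ hr.ne', one_smul]
    have h3 : r ^ (-((n : ℝ) + α)) = r / r ^ ((n : ℝ) + α + 1) := by
      rw [eq_div_iff (by positivity), ← Real.rpow_add hr,
        show -((n : ℝ) + α) + ((n : ℝ) + α + 1) = 1 by ring, Real.rpow_one]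
    rw [h2, real_inner_smul_left, norm_smul, Real.norm_of_nonneg hr.le,
      Real.mul_rpow hr.le (norm_nonneg _), h3]
    ring
  have h4 := Measure.integral_comp_smul_of_nonneg (volume : Measure (Rn n))
    (divKernel α (fun u => φ (r⁻¹ • (u - x))) u) r (hR := hr.le)
  simp_rw [h1, integral_const_mul] at h4
  have hfin : Module.finrank ℝ (Rn n) = n := by simp
  rw [hfin, smul_eq_mul, eq_inv_mul_iff_mul_eq₀ (by positivity), ← mul_assoc, ← Real.rpow_natCast,
    ← Real.rpow_add hr] at h4
  rw [← h4, show (n : ℝ) + -((n : ℝ) + α) = -α by ring]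
  ring

theorem smul_sub_add_smul {n : ℕ} (x : Rn n) {r : ℝ} (hr : 0 < r) (y : Rn n) :
    r⁻¹ • (x + r • y - x) = y := by
  rw [add_sub_cancel_left, smul_smul, inv_mul_cancel₀ hr.ne', one_smul]

theorem add_smul_smul_sub {n : ℕ} (x : Rn n) {r : ℝ} (hr : 0 < r) (u : Rn n) :
    x + r • (r⁻¹ • (u - x)) = u := by
  rw [smul_smul, mul_inv_cancel₀ hr.ne', one_smul, add_sub_cancel]

theorem measurableEmbedding_add_smul {n : ℕ} (x : Rn n) {r : ℝ} (hr : 0 < r) :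
    MeasurableEmbedding (fun y : Rn n => x + r • y) :=
  ((Homeomorph.smulOfNeZero r hr.ne').trans (Homeomorph.addLeft x)).measurableEmbedding

theorem measurableEmbedding_smul_sub {n : ℕ} (x : Rn n) {r : ℝ} (hr : 0 < r) :
    MeasurableEmbedding (fun u : Rn n => r⁻¹ • (u - x)) :=
  ((Homeomorph.subRight x).trans
    (Homeomorph.smulOfNeZero r⁻¹ (inv_ne_zero hr.ne'))).measurableEmbedding

theorem map_add_smul_volume {n : ℕ} (x : Rn n) {r : ℝ} (hr : 0 < r) :
    (volume : Measure (Rn n)).map (fun y => x + r • y) =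
      ENNReal.ofReal (r ^ n)⁻¹ • volume := by
  have hfin : Module.finrank ℝ (Rn n) = n := by simp
  rw [show (fun y : Rn n => x + r • y) = (fun y => x + y) ∘ (fun y => r • y) from rfl,
    ← Measure.map_map (by fun_prop) (by fun_prop), Measure.map_addHaar_smul _ hr.ne', hfin,
    Measure.map_smul, map_add_left_eq_self, abs_of_nonneg (by positivity)]

theorem nullMeasurableSet_rescaled {n : ℕ} {E : Set (Rn n)}
    (hE : NullMeasurableSet E (volume : Measure (Rn n))) (x : Rn n) {r : ℝ} (hr : 0 < r) :
    NullMeasurableSet (rescaled E x r) (volume : Measure (Rn n)) := by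
  refine NullMeasurableSet.preimage hE (f := fun y => x + r • y) ⟨by fun_prop, ?_⟩
  rw [map_add_smul_volume x hr]
  exact Measure.smul_absolutelyContinuous

theorem setIntegral_rescaled {n : ℕ} (E : Set (Rn n)) (x : Rn n) {r : ℝ} (hr : 0 < r)
    (f : Rn n → ℝ) :
    ∫ y in rescaled E x r, f y = (r ^ n)⁻¹ * ∫ u in E, f (r⁻¹ • (u - x)) := by
  have h := (measurableEmbedding_add_smul x hr).setIntegral_map (μ := volume)
    (fun u => f (r⁻¹ • (u - x))) E
  simp_rw [smul_sub_add_smul x hr] at h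
  rw [map_add_smul_volume x hr, Measure.restrict_smul, integral_smul_measure,
    ENNReal.toReal_ofReal (by positivity)] at h
  exact h.symm

/-- The image of `m` under the blow-up `u ↦ (u - x) / r`, normalised by `r ^ (α - n)`. If `m`
is the fractional variation of `χ_E`, this is the fractional variation of `χ_{(E - x) / r}`. -/
noncomputable def scaledMeasure {n : ℕ} (α : ℝ) (m : Measure (Rn n)) (x : Rn n) (r : ℝ) :
    Measure (Rn n) :=
  ENNReal.ofReal (r ^ (α - n)) • m.map (fun u => r⁻¹ • (u - x))

theorem integral_scaledMeasure {n : ℕ} (α : ℝ) (m : Measure (Rn n)) (x : Rn n) {r : ℝ}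
    (hr : 0 < r) (f : Rn n → ℝ) :
    ∫ y, f y ∂(scaledMeasure α m x r) = r ^ (α - n) * ∫ u, f (r⁻¹ • (u - x)) ∂m := by
  rw [scaledMeasure, integral_smul_measure, (measurableEmbedding_smul_sub x hr).integral_map,
    ENNReal.toReal_ofReal (by positivity), smul_eq_mul]

theorem preimage_smul_sub_ball {n : ℕ} (x : Rn n) {r : ℝ} (hr : 0 < r) (R : ℝ) :
    (fun u => r⁻¹ • (u - x)) ⁻¹' Metric.ball 0 R = Metric.ball x (r * R) := by
  ext u
  rw [mem_preimage, mem_ball_zero_iff, norm_smul, norm_inv, Real.norm_of_nonneg hr.le,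
    Metric.mem_ball, dist_eq_norm, inv_mul_lt_iff₀ hr]

theorem setIntegral_ball_scaledMeasure {n : ℕ} (α : ℝ) (m : Measure (Rn n)) (x : Rn n) {r : ℝ}
    (hr : 0 < r) (R : ℝ) (f : Rn n → ℝ) :
    ∫ y in Metric.ball 0 R, f y ∂(scaledMeasure α m x r) =
      r ^ (α - n) * ∫ u in Metric.ball x (r * R), f (r⁻¹ • (u - x)) ∂m := by
  rw [scaledMeasure, Measure.restrict_smul, integral_smul_measure,
    (measurableEmbedding_smul_sub x hr).setIntegral_map, ENNReal.toReal_ofReal (by positivity),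
    preimage_smul_sub_ball x hr, smul_eq_mul]

theorem scaledMeasure_ball {n : ℕ} (α : ℝ) (m : Measure (Rn n)) (x : Rn n) {r : ℝ}
    (hr : 0 < r) (R : ℝ) :
    scaledMeasure α m x r (Metric.ball 0 R) =
      ENNReal.ofReal (r ^ (α - n)) * m (Metric.ball x (r * R)) := by
  rw [scaledMeasure, Measure.smul_apply, (measurableEmbedding_smul_sub x hr).map_apply,
    preimage_smul_sub_ball x hr, smul_eq_mul]

theorem scaledMeasure_real_ball {n : ℕ} (α : ℝ) (m : Measure (Rn n)) (x : Rn n) {r : ℝ}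
    (hr : 0 < r) (R : ℝ) :
    (scaledMeasure α m x r).real (Metric.ball 0 R) =
      r ^ (α - n) * m.real (Metric.ball x (r * R)) := by
  rw [measureReal_def, scaledMeasure_ball α m x hr, ENNReal.toReal_mul,
    ENNReal.toReal_ofReal (by positivity), measureReal_def]

/-- Scaling of the fractional gradient:
`D^α χ_{(E - x) / r} (B) = r ^ (α - n) D^α χ_E (x + r B)`. -/
theorem IsFracGradient.rescaled {n : ℕ} (hn : 0 < n) {α : ℝ} (hα0 : 0 < α) (hα1 : α < 1)
    {E : Set (Rn n)} {m : Measure (Rn n)} {σ : Rn n → Rn n} (h : IsFracGradient α E m σ)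
    (x : Rn n) {r : ℝ} (hr : 0 < r) :
    IsFracGradient α (rescaled E x r) (scaledMeasure α m x r) (fun y => σ (x + r • y)) := by
  have := h.locallyFinite
  refine ⟨⟨fun y => ⟨Metric.ball 0 (‖y‖ + 1), Metric.isOpen_ball.mem_nhds (by simp), ?_⟩⟩,
    h.measurable.comp (by fun_prop), ?_, fun φ hφ => ?_⟩
  · rw [scaledMeasure_ball α m x hr]
    exact ENNReal.mul_lt_top ENNReal.ofReal_lt_top measure_ball_lt_top
  · refine Measure.ae_smul_measure ?_ _
    rw [(measurableEmbedding_smul_sub x hr).ae_map_iff]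
    simp_rw [add_smul_smul_sub x hr]
    exact h.norm_eq_one
  · rw [setIntegral_rescaled E x hr, integral_scaledMeasure α m x hr]
    simp_rw [add_smul_smul_sub x hr]
    have h2 : ∀ u, fracDiv α φ (r⁻¹ • (u - x)) =
        r ^ α * fracDiv α (fun u => φ (r⁻¹ • (u - x))) u := by
      intro u
      rw [fracDiv_comp_dilation hn hα0 hα1 hφ x hr, ← mul_assoc, ← Real.rpow_add hr]
      simp
    simp_rw [h2]
    rw [integral_const_mul, h.gaussGreen _ (hφ.comp_dilation x hr), Real.rpow_sub hr,
      Real.rpow_natCast]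
    ring

/-! ### Density bound at points of the reduced boundary -/

theorem isTestField_smul {n : ℕ} {g : Rn n → ℝ} (hg : ContDiff ℝ ∞ g) (hc : HasCompactSupport g)
    (v : Rn n) : IsTestField univ (fun y => g y • v) :=
  ⟨hg.smul contDiff_const, hc.smul_right, subset_univ _⟩

theorem IsFracGradient.integrable_inner {n : ℕ} {α : ℝ} {E : Set (Rn n)} {m : Measure (Rn n)}
    {σ : Rn n → Rn n} (h : IsFracGradient α E m σ) {φ : Rn n → Rn n} (hφ : Continuous φ)
    (hc : HasCompactSupport φ) : Integrable (fun y => inner ℝ (φ y) (σ y)) m := by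
  have := h.locallyFinite
  refine (hφ.integrable_of_hasCompactSupport hc).norm.mono'
    (hφ.aestronglyMeasurable.inner h.measurable.aestronglyMeasurable) ?_
  filter_upwards [h.norm_eq_one] with y hy
  simpa [hy] using norm_inner_le_norm (𝕜 := ℝ) (φ y) (σ y)

theorem IsFracGradient.locallyIntegrable {n : ℕ} {α : ℝ} {E : Set (Rn n)} {m : Measure (Rn n)}
    {σ : Rn n → Rn n} (h : IsFracGradient α E m σ) : LocallyIntegrable σ m := by
  have := h.locallyFinite
  refine (locallyIntegrable_const (1 : ℝ)).mono h.measurable.aestronglyMeasurable ?_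
  filter_upwards [h.norm_eq_one] with y hy
  simp [hy]

theorem IsFracGradient.integrableOn_ball {n : ℕ} {α : ℝ} {E : Set (Rn n)} {m : Measure (Rn n)}
    {σ : Rn n → Rn n} (h : IsFracGradient α E m σ) (x : Rn n) (r : ℝ) :
    IntegrableOn σ (Metric.ball x r) m :=
  (h.locallyIntegrable.integrableOn_isCompact (isCompact_closedBall x r)).mono_set
    Metric.ball_subset_closedBall

theorem IsFracGradient.integrableOn_ball_one_sub {n : ℕ} {α : ℝ} {E : Set (Rn n)}
    {m : Measure (Rn n)} {σ : Rn n → Rn n} (h : IsFracGradient α E m σ) (v x : Rn n) (r : ℝ) :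
    IntegrableOn (fun y => 1 - inner ℝ v (σ y)) (Metric.ball x r) m := by
  have := h.locallyFinite
  exact (integrableOn_const measure_ball_lt_top.ne).sub ((h.integrableOn_ball x r).const_inner v)

theorem IsFracGradient.setIntegral_ball_one_sub {n : ℕ} {α : ℝ} {E : Set (Rn n)}
    {m : Measure (Rn n)} {σ : Rn n → Rn n} (h : IsFracGradient α E m σ) (v x : Rn n) (r : ℝ) :
    ∫ y in Metric.ball x r, (1 - inner ℝ v (σ y)) ∂m =
      m.real (Metric.ball x r) - inner ℝ v (∫ y in Metric.ball x r, σ y ∂m) := by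
  have := h.locallyFinite
  have h1 : Integrable (fun _ => (1 : ℝ)) (m.restrict (Metric.ball x r)) :=
    integrableOn_const measure_ball_lt_top.ne
  rw [integral_sub h1 ((h.integrableOn_ball x r).const_inner v),
    integral_inner (h.integrableOn_ball x r)]
  simp

theorem IsFracGradient.one_sub_inner_nonneg {n : ℕ} {α : ℝ} {E : Set (Rn n)}
    {m : Measure (Rn n)} {σ : Rn n → Rn n} (h : IsFracGradient α E m σ) {v : Rn n}
    (hv : ‖v‖ = 1) : ∀ᵐ y ∂m, 0 ≤ 1 - inner ℝ v (σ y) := by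
  filter_upwards [h.norm_eq_one] with y hy
  have := real_inner_le_norm v (σ y)
  rw [hv, hy] at this
  linarith

/-- Testing the Gauss–Green formula with a cut-off of the constant field `v` bounds the mass of the
unit ball by a constant independent of the set, up to the deviation of the density from `v`. -/
theorem exists_measureReal_ball_le {n : ℕ} (hn : 0 < n) {α : ℝ} (hα0 : 0 < α) (hα1 : α < 1)
    {v : Rn n} (hv : ‖v‖ = 1) :
    ∃ C : ℝ, ∀ (E : Set (Rn n)) (m : Measure (Rn n)) (σ : Rn n → Rn n),
      IsFracGradient α E m σ → m.real (Metric.ball 0 1) ≤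
        C + ∫ y in Metric.ball 0 2, (1 - inner ℝ v (σ y)) ∂m := by
  let f : ContDiffBump (0 : Rn n) := ⟨1, 2, by norm_num, by norm_num⟩
  have hφ : IsTestField univ (fun y => f y • v) := isTestField_smul f.contDiff f.hasCompactSupport v
  have hI := integrable_fracDiv hn hα0 hα1 hφ
  refine ⟨∫ y, |fracDiv α (fun y => f y • v) y|, fun E m σ h => ?_⟩
  have := h.locallyFinite
  have hgg := h.gaussGreen _ hφ
  have h1 : -∫ y in E, fracDiv α (fun y => f y • v) y ≤ ∫ y, |fracDiv α (fun y => f y • v) y| := by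
    refine (neg_le_abs _).trans ?_
    rw [← Real.norm_eq_abs]
    refine (norm_integral_le_integral_norm _).trans ?_
    exact setIntegral_le_integral hI.norm (ae_of_all _ fun _ => norm_nonneg _)
  have hf : Integrable (fun y => f y) m :=
    f.continuous.integrable_of_hasCompactSupport f.hasCompactSupport
  have hfσ := h.integrable_inner hφ.smooth.continuous hφ.compactSupport
  have h2 : m.real (Metric.ball 0 1) ≤ ∫ y, f y ∂m := by
    rw [← integral_indicator_one Metric.isOpen_ball.measurableSet]
    refine integral_mono ((integrable_indicator_iff Metric.isOpen_ball.measurableSet).2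
      (integrableOn_const measure_ball_lt_top.ne)) hf fun y => ?_
    by_cases hy : y ∈ Metric.ball (0 : Rn n) 1
    · rw [indicator_of_mem hy, f.one_of_mem_closedBall (Metric.ball_subset_closedBall hy)]; rfl
    · rw [indicator_of_notMem hy]; exact f.nonneg
  have h3 : ∫ y, f y ∂m - ∫ y, inner ℝ (f y • v) (σ y) ∂m ≤
      ∫ y in Metric.ball 0 2, (1 - inner ℝ v (σ y)) ∂m := by
    rw [← integral_sub hf hfσ, ← integral_indicator Metric.isOpen_ball.measurableSet]
    refine integral_mono_ae (hf.sub hfσ)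
      ((integrable_indicator_iff Metric.isOpen_ball.measurableSet).2
        (h.integrableOn_ball_one_sub v 0 2)) ?_
    filter_upwards [h.one_sub_inner_nonneg hv] with y hy
    rw [real_inner_smul_left]
    by_cases hy2 : y ∈ Metric.ball (0 : Rn n) 2
    · rw [indicator_of_mem hy2]
      nlinarith [f.le_one (x := y)]
    · rw [indicator_of_notMem hy2, f.zero_of_le_dist (by simpa using hy2)]
      simp
  linarith

/-- If passing from `2 * r` to `r` halves a quantity up to an additive constant, then the quantity
stays bounded as `r → 0`. -/
theorem le_max_of_dyadic_decay {a : ℝ → ℝ} {r₀ C M : ℝ} (hr₀ : 0 < r₀)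
    (hstep : ∀ r, 0 < r → 2 * r ≤ r₀ → a r ≤ C + a (2 * r) / 2)
    (hM : ∀ r, r₀ / 2 < r → r ≤ r₀ → a r ≤ M) {r : ℝ} (hr : 0 < r) (hr' : r ≤ r₀) :
    a r ≤ max (2 * C) M := by
  have key : ∀ k : ℕ, ∀ r, r₀ / 2 ^ (k + 1) < r → r ≤ r₀ → a r ≤ max (2 * C) M := by
    intro k
    induction k with
    | zero => intro r h1 h2; exact (hM r (by simpa using h1) h2).trans (le_max_right _ _)
    | succ k ih =>
      intro r h1 h2
      rcases lt_or_ge (r₀ / 2) r with h | h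
      · exact (hM r h h2).trans (le_max_right _ _)
      · have hr0 : 0 < r := lt_trans (by positivity) h1
        have h3 := hstep r hr0 (by linarith)
        have h4 := ih (2 * r) (by
          rw [pow_succ, ← div_div] at h1; linarith) (by linarith)
        linarith [le_max_left (2 * C) M]
  obtain ⟨k, hk⟩ := exists_pow_lt_of_lt_one (div_pos hr hr₀) (by norm_num : (1 / 2 : ℝ) < 1)
  refine key k r ?_ hr'
  rw [lt_div_iff₀ hr₀] at hk
  refine lt_of_le_of_lt ?_ hk
  rw [one_div, inv_pow, div_eq_inv_mul]
  gcongr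
  · norm_num
  · simp

/-- The density bound `|D^α χ_E| (B_r(x)) = O(r ^ (n - α))` at a point where the density of
`D^α χ_E` has the average `v`. -/
theorem IsFracGradient.exists_rpow_mul_measureReal_ball_le {n : ℕ} (hn : 0 < n) {α : ℝ}
    (hα0 : 0 < α) (hα1 : α < 1) {E : Set (Rn n)} {m : Measure (Rn n)} {σ : Rn n → Rn n}
    (h : IsFracGradient α E m σ) (x : Rn n) {v : Rn n} (hv : ‖v‖ = 1)
    (hdev : ∀ ε > 0, ∃ r₀ > 0, ∀ r, 0 < r → r ≤ r₀ →
      ∫ y in Metric.ball x r, (1 - inner ℝ v (σ y)) ∂m ≤ ε * m.real (Metric.ball x r)) :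
    ∃ C r₀ : ℝ, 0 < r₀ ∧ ∀ r, 0 < r → r ≤ r₀ → r ^ (α - n) * m.real (Metric.ball x r) ≤ C := by
  have := h.locallyFinite
  obtain ⟨C, hC⟩ := exists_measureReal_ball_le hn hα0 hα1 hv
  -- with this `ε` the error term in the step from `2 * r` to `r` is halved
  obtain ⟨r₀, hr₀, hr₀'⟩ := hdev (2 ^ (α - n) / 2) (by positivity)
  refine ⟨_, r₀, hr₀, fun r hr hr' => le_max_of_dyadic_decay
    (a := fun r => r ^ (α - n) * m.real (Metric.ball x r)) (C := C)
    (M := (r₀ / 2) ^ (α - n) * m.real (Metric.ball x r₀)) hr₀ (fun r hr hr2 => ?_)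
    (fun r h1 h2 => ?_) hr hr'⟩
  · have h1 := hC _ _ _ (h.rescaled hn hα0 hα1 x hr)
    rw [scaledMeasure_real_ball α m x hr, setIntegral_ball_scaledMeasure α m x hr, mul_one] at h1
    simp_rw [add_smul_smul_sub x hr] at h1
    have h2 := hr₀' (2 * r) (by positivity) hr2
    rw [mul_comm r 2] at h1
    refine h1.trans ?_
    have h3 : 0 ≤ r ^ (α - n) := by positivity
    have h4 := mul_le_mul_of_nonneg_left h2 h3
    rw [Real.mul_rpow (by norm_num) hr.le]
    linarith
  · have hn1 : (1 : ℝ) ≤ n := by exact_mod_cast hn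
    gcongr ?_ * ?_
    · exact Real.rpow_le_rpow_of_nonpos (by positivity) h1.le (by linarith)
    · exact measureReal_mono (Metric.ball_subset_ball h2) measure_ball_lt_top.ne

/-! ### Limits of fractional gradients -/

/-- `L¹_loc` convergence of characteristic functions, tested against a bounded integrable
function. -/
theorem TendstoL1Loc.tendsto_setIntegral {n : ℕ} {A : ℕ → Set (Rn n)} {F : Set (Rn n)}
    (h : TendstoL1Loc A F) (hA : ∀ k, NullMeasurableSet (A k) (volume : Measure (Rn n)))
    (hF : NullMeasurableSet F (volume : Measure (Rn n))) {f : Rn n → ℝ} (hf : Integrable f)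
    {C : ℝ} (hC : ∀ x, |f x| ≤ C) :
    Tendsto (fun k => ∫ y in A k, f y) atTop (𝓝 (∫ y in F, f y)) := by
  set d : ℕ → Rn n → ℝ := fun k =>
    (A k).indicator (fun _ => (1 : ℝ)) - F.indicator (fun _ => (1 : ℝ)) with hd
  have hdm : ∀ k, AEStronglyMeasurable (d k) := fun k =>
    (aestronglyMeasurable_const.indicator₀ (hA k)).sub (aestronglyMeasurable_const.indicator₀ hF)
  have hd1 : ∀ k y, |d k y| ≤ 1 := by
    intro k y
    by_cases h1 : y ∈ A k <;> by_cases h2 : y ∈ F <;> simp [hd, h1, h2]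
  have hdf : ∀ k, Integrable (fun y => d k y * f y) := fun k =>
    hf.bdd_mul (hdm k) (c := 1) (ae_of_all _ fun y => hd1 k y)
  have hdiff : ∀ k, (∫ y in A k, f y) - (∫ y in F, f y) = ∫ y, d k y * f y := by
    intro k
    rw [← integral_indicator₀ (hA k), ← integral_indicator₀ hF,
      ← integral_sub (hf.indicator₀ (hA k)) (hf.indicator₀ hF)]
    congr 1 with y
    by_cases h1 : y ∈ A k <;> by_cases h2 : y ∈ F <;> simp [hd, h1, h2]
  have hC0 : 0 ≤ C := (abs_nonneg _).trans (hC 0)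
  rw [Metric.tendsto_atTop']
  intro ε hε
  have htail : Tendsto (fun R : ℝ => ∫ y in Metric.closedBall 0 R, |f y|) atTop
      (𝓝 (∫ y, |f y|)) :=
    (aecover_closedBall tendsto_id).integral_tendsto_of_countably_generated hf.abs
  obtain ⟨R, hR⟩ := ((tendsto_order.1 htail).1 ((∫ y, |f y|) - ε / 2) (by linarith)).exists
  set K := Metric.closedBall (0 : Rn n) R with hK
  have hKm : MeasurableSet K := Metric.isClosed_closedBall.measurableSet
  have hcomp : ∫ y in Kᶜ, |f y| < ε / 2 := by
    have := integral_add_compl hKm hf.abs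
    linarith
  have hone : Integrable (fun _ => (1 : ℝ)) (volume.restrict K) :=
    integrableOn_const (isCompact_closedBall _ _).measure_lt_top.ne
  have hdint : ∀ k, IntegrableOn (d k) K := fun k =>
    hone.mono' (hdm k).restrict (ae_of_all _ fun y => hd1 k y)
  have hlim : Tendsto (fun k => C * ∫ y in K, |d k y|) atTop (𝓝 0) := by
    have h1 := (ENNReal.tendsto_toReal ENNReal.zero_ne_top).comp
      (h K (isCompact_closedBall _ _))
    have h2 : ∀ k, (eLpNorm (d k) 1 (volume.restrict K)).toReal = ∫ y in K, |d k y| := by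
      intro k
      rw [eLpNorm_one_eq_lintegral_enorm, ← integral_norm_eq_lintegral_enorm (hdm k).restrict]
      rfl
    have h3 : Tendsto (fun k => ∫ y in K, |d k y|) atTop (𝓝 0) := by
      simp_rw [← h2]
      exact h1
    simpa using h3.const_mul C
  obtain ⟨N, hN⟩ := eventually_atTop.1 ((tendsto_order.1 hlim).2 (ε / 2) (by linarith))
  refine ⟨N, fun k hk => ?_⟩
  rw [Real.dist_eq, hdiff k]
  have hKbd : ∫ y in K, |d k y * f y| ≤ C * ∫ y in K, |d k y| := by
    rw [← integral_const_mul]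
    refine integral_mono (hdf k).abs.integrableOn ((hdint k).abs.const_mul C) fun y => ?_
    simp only [abs_mul]
    rw [mul_comm]
    gcongr
    exact hC y
  have hKc : ∫ y in Kᶜ, |d k y * f y| ≤ ∫ y in Kᶜ, |f y| := by
    refine integral_mono (hdf k).abs.integrableOn hf.abs.integrableOn fun y => ?_
    simp only [abs_mul]
    exact mul_le_of_le_one_left (abs_nonneg _) (hd1 k y)
  have h4 := integral_add_compl hKm (hdf k).abs
  have h5 := abs_integral_le_integral_abs (f := fun y => d k y * f y) (μ := volume)
  have h6 := hN k hk.le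
  linarith

/-- If `(1 - ⟨v, σ⟩) m` vanishes locally in the limit, then so does `‖σ - v‖ m`. -/
theorem tendsto_setIntegral_norm_sub {n : ℕ} {α : ℝ} {A : ℕ → Set (Rn n)}
    {m : ℕ → Measure (Rn n)} {σ : ℕ → Rn n → Rn n} (h : ∀ k, IsFracGradient α (A k) (m k) (σ k))
    {v : Rn n} (hv : ‖v‖ = 1) {R C : ℝ} (hmass : ∀ᶠ k in atTop, (m k).real (Metric.ball 0 R) ≤ C)
    (hdev : Tendsto (fun k => ∫ y in Metric.ball 0 R, (1 - inner ℝ v (σ k y)) ∂(m k)) atTop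
      (𝓝 0)) :
    Tendsto (fun k => ∫ y in Metric.ball 0 R, ‖σ k y - v‖ ∂(m k)) atTop (𝓝 0) := by
  have hC0 : 0 ≤ C := by
    obtain ⟨k, hk⟩ := hmass.exists
    exact measureReal_nonneg.trans hk
  rw [Metric.tendsto_atTop']
  intro ε hε
  -- integrate `t ≤ δ + t² / δ` for `t = ‖σ - v‖`, whose square is `2 (1 - ⟨v, σ⟩)`
  set δ : ℝ := ε / (2 * (C + 1)) with hδ
  have hδ0 : 0 < δ := by positivity
  have hlim : Tendsto (fun k => 2 / δ * ∫ y in Metric.ball 0 R, (1 - inner ℝ v (σ k y)) ∂(m k))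
      atTop (𝓝 0) := by simpa using hdev.const_mul (2 / δ)
  obtain ⟨N, hN⟩ := eventually_atTop.1
    (((tendsto_order.1 hlim).2 (ε / 2) (by linarith)).and hmass)
  refine ⟨N, fun k hk => ?_⟩
  obtain ⟨h1, h2⟩ := hN k hk.le
  have := (h k).locallyFinite
  have hi1 : Integrable (fun _ => δ) ((m k).restrict (Metric.ball 0 R)) :=
    integrableOn_const measure_ball_lt_top.ne
  have hi2 : Integrable (fun y => 1 - inner ℝ v (σ k y)) ((m k).restrict (Metric.ball 0 R)) :=
    (h k).integrableOn_ball_one_sub v 0 R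
  have hi3 : Integrable (fun _ => v) ((m k).restrict (Metric.ball 0 R)) :=
    integrableOn_const measure_ball_lt_top.ne
  have hle : ∫ y in Metric.ball 0 R, ‖σ k y - v‖ ∂(m k) ≤
      ∫ y in Metric.ball 0 R, (δ + 2 / δ * (1 - inner ℝ v (σ k y))) ∂(m k) := by
    refine integral_mono_ae (((h k).integrableOn_ball 0 R).sub hi3).norm
      (hi1.add (hi2.const_mul _)) ?_
    filter_upwards [ae_restrict_of_ae (h k).norm_eq_one] with y hy
    have hsq : ‖σ k y - v‖ ^ 2 = 2 * (1 - inner ℝ v (σ k y)) := by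
      rw [norm_sub_sq_real, hy, hv, real_inner_comm]; ring
    rw [div_mul_eq_mul_div, ← hsq]
    have : ‖σ k y - v‖ * δ ≤ δ * δ + ‖σ k y - v‖ ^ 2 := by
      nlinarith [sq_nonneg (‖σ k y - v‖ - δ), norm_nonneg (σ k y - v)]
    rw [← mul_le_mul_iff_left₀ hδ0, add_mul, div_mul_cancel₀ _ hδ0.ne']
    exact this
  rw [integral_add hi1 (hi2.const_mul _), integral_const_mul] at hle
  simp only [integral_const, measureReal_restrict_apply_univ, smul_eq_mul] at hle
  have h3 : (m k).real (Metric.ball 0 R) * δ ≤ ε / 2 := by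
    calc _ ≤ (C + 1) * δ := by gcongr; linarith
      _ = ε / 2 := by rw [hδ]; field_simp
  rw [Real.dist_eq, sub_zero, abs_of_nonneg (integral_nonneg fun _ => norm_nonneg _)]
  linarith

/-- If `E_k → F` in `L¹_loc`, the masses of `D^α χ_{E_k}` are locally bounded and their
densities converge to the constant `v`, then `v · m_k → D^α χ_F` when tested against smooth
fields. -/
theorem tendsto_integral_inner_const {n : ℕ} (hn : 0 < n) {α : ℝ} (hα0 : 0 < α) (hα1 : α < 1)
    {A : ℕ → Set (Rn n)} {F : Set (Rn n)} (hAF : TendstoL1Loc A F)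
    (hA : ∀ k, NullMeasurableSet (A k) (volume : Measure (Rn n)))
    (hF : NullMeasurableSet F (volume : Measure (Rn n)))
    {m : ℕ → Measure (Rn n)} {σ : ℕ → Rn n → Rn n} (h : ∀ k, IsFracGradient α (A k) (m k) (σ k))
    {v : Rn n} (hv : ‖v‖ = 1)
    (hmass : ∀ R : ℝ, ∃ C, ∀ᶠ k in atTop, (m k).real (Metric.ball 0 R) ≤ C)
    (hdev : ∀ R : ℝ, Tendsto (fun k => ∫ y in Metric.ball 0 R, (1 - inner ℝ v (σ k y)) ∂(m k))
      atTop (𝓝 0)) {φ : Rn n → Rn n} (hφ : IsTestField univ φ) :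
    Tendsto (fun k => ∫ y, inner ℝ (φ y) v ∂(m k)) atTop (𝓝 (-∫ y in F, fracDiv α φ y)) := by
  obtain ⟨B, hB⟩ := exists_abs_fracDiv_le hn hα0 hα1 hφ
  have h1 : Tendsto (fun k => ∫ y, inner ℝ (φ y) (σ k y) ∂(m k)) atTop
      (𝓝 (-∫ y in F, fracDiv α φ y)) := by
    refine (hAF.tendsto_setIntegral hA hF (integrable_fracDiv hn hα0 hα1 hφ) hB).neg.congr
      fun k => ?_
    rw [(h k).gaussGreen φ hφ, neg_neg]
  obtain ⟨R, hR⟩ := hφ.compactSupport.isBounded.subset_ball 0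
  obtain ⟨M, hM⟩ := hφ.compactSupport.exists_bound_of_continuous hφ.smooth.continuous
  obtain ⟨C, hC⟩ := hmass R
  have h2 := (tendsto_setIntegral_norm_sub h hv hC (hdev R)).const_mul M
  rw [mul_zero] at h2
  have h3 : Tendsto (fun k => ∫ y, inner ℝ (φ y) (σ k y) ∂(m k) - ∫ y, inner ℝ (φ y) v ∂(m k))
      atTop (𝓝 0) := by
    refine squeeze_zero_norm (fun k => ?_) h2
    have := (h k).locallyFinite
    have hi1 := (h k).integrable_inner hφ.smooth.continuous hφ.compactSupport
    have hi2 : Integrable (fun y => inner ℝ (φ y) v) (m k) :=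
      (hφ.smooth.continuous.integrable_of_hasCompactSupport hφ.compactSupport).inner_const v
    have hi3 : Integrable (fun _ => v) ((m k).restrict (Metric.ball 0 R)) :=
      integrableOn_const measure_ball_lt_top.ne
    rw [← integral_sub hi1 hi2, ← integral_const_mul,
      ← integral_indicator Metric.isOpen_ball.measurableSet]
    refine norm_integral_le_of_norm_le ((integrable_indicator_iff
      Metric.isOpen_ball.measurableSet).2
        (((((h k).integrableOn_ball 0 R).sub hi3).norm).const_mul M)) (ae_of_all _ fun y => ?_)
    rw [← inner_sub_right]
    by_cases hy : y ∈ Metric.ball (0 : Rn n) R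
    · rw [indicator_of_mem hy]
      exact (norm_inner_le_norm _ _).trans (by gcongr; exact hM y)
    · rw [indicator_of_notMem hy, image_eq_zero_of_notMem_tsupport (fun h => hy (hR h))]
      simp
  simpa using h1.sub h3

/-- Continuous functions with compact support are approximated by smooth ones, in the sense of
integrals and uniformly with respect to the measure. -/
theorem exists_contDiff_abs_integral_sub_le {n : ℕ} {g : Rn n → ℝ} (hg : Continuous g)
    (hc : HasCompactSupport g) {ε : ℝ} (hε : 0 < ε) :
    ∃ f : Rn n → ℝ, ContDiff ℝ ∞ f ∧ HasCompactSupport f ∧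
      ∀ μ : Measure (Rn n), IsLocallyFiniteMeasure μ →
        |∫ y, g y ∂μ - ∫ y, f y ∂μ| ≤ ε * μ.real (tsupport g) := by
  obtain ⟨f, hf, hfg, hfs⟩ := hg.exists_contDiff_approx (ε := fun _ => ε) ⊤ continuous_const
    fun _ => hε
  have hfc : HasCompactSupport f := hc.mono hfs
  refine ⟨f, hf, hfc, fun μ _ => ?_⟩
  rw [← integral_sub (hg.integrable_of_hasCompactSupport hc)
    (hf.continuous.integrable_of_hasCompactSupport hfc)]
  have hi : Integrable ((tsupport g).indicator fun _ => ε) μ :=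
    (integrable_indicator_iff (isClosed_tsupport g).measurableSet).2
      (integrableOn_const hc.measure_lt_top.ne)
  rw [← Real.norm_eq_abs]
  refine (norm_integral_le_of_norm_le hi (ae_of_all _ fun y => ?_)).trans ?_
  · by_cases hy : y ∈ tsupport g
    · rw [indicator_of_mem hy, ← dist_eq_norm, dist_comm]
      exact (hfg y).le
    · have h0 : g y = 0 := image_eq_zero_of_notMem_tsupport hy
      have h1 : f y = 0 := by
        by_contra h
        exact hfs h h0
      simp [h0, h1, hy]
  · rw [integral_indicator (isClosed_tsupport g).measurableSet]
    simp [mul_comm]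

/-- Locally bounded sequences of measures which converge when tested against smooth functions
also converge when tested against continuous functions with compact support. -/
theorem exists_tendsto_integral_of_contDiff {n : ℕ} {m : ℕ → Measure (Rn n)}
    [∀ k, IsLocallyFiniteMeasure (m k)]
    (hmass : ∀ R : ℝ, ∃ C, ∀ᶠ k in atTop, (m k).real (Metric.ball 0 R) ≤ C)
    (hlim : ∀ g : Rn n → ℝ, ContDiff ℝ ∞ g → HasCompactSupport g →
      ∃ l, Tendsto (fun k => ∫ y, g y ∂(m k)) atTop (𝓝 l))
    {g : Rn n → ℝ} (hg : Continuous g) (hc : HasCompactSupport g) :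
    ∃ l, Tendsto (fun k => ∫ y, g y ∂(m k)) atTop (𝓝 l) := by
  refine cauchySeq_tendsto_of_complete (Metric.cauchySeq_iff'.2 fun ε hε => ?_)
  obtain ⟨R, hR⟩ := hc.isBounded.subset_ball 0
  obtain ⟨C, hC⟩ := hmass R
  have hC0 : 0 ≤ C := by
    obtain ⟨k, hk⟩ := hC.exists
    exact measureReal_nonneg.trans hk
  set δ : ℝ := ε / (4 * (C + 1)) with hδ
  have hδ0 : 0 < δ := by positivity
  obtain ⟨f, hf, hfc, hfg⟩ := exists_contDiff_abs_integral_sub_le hg hc hδ0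
  obtain ⟨l, hl⟩ := hlim f hf hfc
  obtain ⟨N, hN⟩ := eventually_atTop.1 ((Metric.tendsto_nhds.1 hl (ε / 8) (by positivity)).and hC)
  have key : ∀ k ≥ N, |∫ y, g y ∂(m k) - ∫ y, f y ∂(m k)| ≤ ε / 4 := by
    intro k hk
    have hmono : (m k).real (tsupport g) ≤ C + 1 :=
      (measureReal_mono hR measure_ball_lt_top.ne).trans (by linarith [(hN k hk).2])
    calc _ ≤ δ * (m k).real (tsupport g) := hfg (m k) inferInstance
      _ ≤ δ * (C + 1) := by gcongr
      _ = ε / 4 := by rw [hδ]; field_simp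
  refine ⟨N, fun k hk => ?_⟩
  have h1 := abs_le.1 (key k hk)
  have h2 := abs_le.1 (key N le_rfl)
  have h3 := abs_lt.1 ((Real.dist_eq _ _).symm.trans_lt (hN k hk).1)
  have h4 := abs_lt.1 ((Real.dist_eq _ _).symm.trans_lt (hN N le_rfl).1)
  rw [Real.dist_eq, abs_lt]
  constructor <;> linarith

open scoped CompactlySupported in
/-- A sequence of measures converging when tested against continuous functions with compact
support has a vague limit. -/
theorem exists_measure_tendsto_integral {n : ℕ} {m : ℕ → Measure (Rn n)}
    [∀ k, IsLocallyFiniteMeasure (m k)]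
    (hlim : ∀ g : Rn n → ℝ, Continuous g → HasCompactSupport g →
      ∃ l, Tendsto (fun k => ∫ y, g y ∂(m k)) atTop (𝓝 l)) :
    ∃ μ : Measure (Rn n), IsLocallyFiniteMeasure μ ∧
      ∀ g : Rn n → ℝ, Continuous g → HasCompactSupport g →
        Tendsto (fun k => ∫ y, g y ∂(m k)) atTop (𝓝 (∫ y, g y ∂μ)) := by
  choose L hL using fun g : C_c(Rn n, ℝ) => hlim g g.continuous g.hasCompactSupport
  have hi : ∀ (g : C_c(Rn n, ℝ)) k, Integrable (fun y => g y) (m k) := fun g k =>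
    g.continuous.integrable_of_hasCompactSupport g.hasCompactSupport
  let Λ₀ : C_c(Rn n, ℝ) →ₗ[ℝ] ℝ :=
    { toFun := L
      map_add' := fun f g => by
        refine tendsto_nhds_unique (hL (f + g)) (((hL f).add (hL g)).congr fun k => ?_)
        rw [← integral_add (hi f k) (hi g k)]
        rfl
      map_smul' := fun c f => by
        refine tendsto_nhds_unique (hL (c • f)) (((hL f).const_mul c).congr fun k => ?_)
        rw [← integral_const_mul]
        rfl }
  let Λ : C_c(Rn n, ℝ) →ₚ[ℝ] ℝ := PositiveLinearMap.mk₀ Λ₀ fun f hf =>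
    ge_of_tendsto' (hL f) fun k => integral_nonneg fun y => hf y
  refine ⟨RealRMK.rieszMeasure Λ, inferInstance, fun g hg hc => ?_⟩
  have h1 : ∫ y, g y ∂(RealRMK.rieszMeasure Λ) = L ⟨⟨g, hg⟩, hc⟩ :=
    RealRMK.integral_rieszMeasure Λ ⟨⟨g, hg⟩, hc⟩
  rw [h1]
  exact hL ⟨⟨g, hg⟩, hc⟩

/-- If `E_k → F` in `L¹_loc`, the masses of `D^α χ_{E_k}` are locally bounded and their
densities converge to the constant `v`, then `D^α χ_F` exists and has the constant density `v`. -/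
theorem exists_isFracGradient_const_of_tendsto {n : ℕ} (hn : 0 < n) {α : ℝ} (hα0 : 0 < α)
    (hα1 : α < 1) {A : ℕ → Set (Rn n)} {F : Set (Rn n)} (hAF : TendstoL1Loc A F)
    (hA : ∀ k, NullMeasurableSet (A k) (volume : Measure (Rn n)))
    (hF : NullMeasurableSet F (volume : Measure (Rn n)))
    {m : ℕ → Measure (Rn n)} {σ : ℕ → Rn n → Rn n} (h : ∀ k, IsFracGradient α (A k) (m k) (σ k))
    {v : Rn n} (hv : ‖v‖ = 1)
    (hmass : ∀ R : ℝ, ∃ C, ∀ᶠ k in atTop, (m k).real (Metric.ball 0 R) ≤ C)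
    (hdev : ∀ R : ℝ, Tendsto (fun k => ∫ y in Metric.ball 0 R, (1 - inner ℝ v (σ k y)) ∂(m k))
      atTop (𝓝 0)) :
    ∃ μ : Measure (Rn n), IsFracGradient α F μ (fun _ => v) := by
  have := fun k => (h k).locallyFinite
  have key := fun φ (hφ : IsTestField univ φ) =>
    tendsto_integral_inner_const hn hα0 hα1 hAF hA hF h hv hmass hdev hφ
  obtain ⟨μ, hμ, hlim⟩ := exists_measure_tendsto_integral (m := m) fun g hg hc =>
    exists_tendsto_integral_of_contDiff hmass (fun f hf hfc => ⟨_, by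
      simpa [real_inner_smul_left, hv] using key _ (isTestField_smul hf hfc v)⟩) hg hc
  refine ⟨μ, hμ, measurable_const, ae_of_all _ fun _ => hv, fun φ hφ => ?_⟩
  have h1 := hlim (fun y => inner ℝ (φ y) v) (hφ.smooth.continuous.inner continuous_const)
    (hφ.compactSupport.comp_left (g := fun w => inner ℝ w v) (inner_zero_left v))
  rw [tendsto_nhds_unique h1 (key φ hφ), neg_neg]

/-! ### Uniqueness of the polar decomposition -/

/-- Locally finite measures on `ℝⁿ` are determined by their integrals of test functions. -/
theorem measure_ext_of_integral_contDiff {n : ℕ} {μ₁ μ₂ : Measure (Rn n)}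
    [IsLocallyFiniteMeasure μ₁] [IsLocallyFiniteMeasure μ₂]
    (h : ∀ g : Rn n → ℝ, ContDiff ℝ ∞ g → HasCompactSupport g → ∫ y, g y ∂μ₁ = ∫ y, g y ∂μ₂) :
    μ₁ = μ₂ := by
  refine Measure.ext_of_integral_eq_on_compactlySupported fun g => ?_
  have key : ∀ ε > 0, |∫ y, g y ∂μ₁ - ∫ y, g y ∂μ₂| ≤
      ε * (μ₁.real (tsupport g) + μ₂.real (tsupport g)) := by
    intro ε hε
    obtain ⟨f, hf, hfc, hfg⟩ :=
      exists_contDiff_abs_integral_sub_le (g := g) g.continuous g.hasCompactSupport hε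
    have h1 := abs_le.1 (hfg μ₁ inferInstance)
    have h2 := abs_le.1 (hfg μ₂ inferInstance)
    have h3 := h f hf hfc
    rw [mul_add, abs_le]
    constructor <;> linarith
  set c := μ₁.real (tsupport g) + μ₂.real (tsupport g)
  have hlim : Tendsto (fun ε : ℝ => ε * c) (𝓝[>] 0) (𝓝 0) := by
    have : Tendsto (fun ε : ℝ => ε * c) (𝓝 0) (𝓝 (0 * c)) := tendsto_id.mul_const c
    rw [zero_mul] at this
    exact this.mono_left nhdsWithin_le_nhds
  have h0 : |∫ y, g y ∂μ₁ - ∫ y, g y ∂μ₂| ≤ 0 :=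
    ge_of_tendsto hlim (by filter_upwards [self_mem_nhdsWithin] with ε hε using key ε hε)
  exact sub_eq_zero.1 (abs_nonpos_iff.1 h0)

/-- Uniqueness of the polar decomposition, when one of the densities is constant. -/
theorem IsFracGradient.ae_eq_of_const {n : ℕ} {α : ℝ} {F : Set (Rn n)} {m μ : Measure (Rn n)}
    {σ : Rn n → Rn n} {v : Rn n} (hv : ‖v‖ = 1) (h : IsFracGradient α F m σ)
    (hμ : IsFracGradient α F μ (fun _ => v)) : ∀ᵐ y ∂m, σ y = v := by
  have := h.locallyFinite
  have := hμ.locallyFinite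
  have hvv : inner ℝ v v = (1 : ℝ) := by rw [real_inner_self_eq_norm_sq, hv, one_pow]
  have hgi : ∀ g : Rn n → ℝ, ContDiff ℝ ∞ g → HasCompactSupport g → ∀ w : Rn n,
      Integrable (fun y => g y * inner ℝ w (σ y)) m := fun g hg hc w => by
    have hφ := isTestField_smul hg hc w
    simpa only [real_inner_smul_left] using
      h.integrable_inner hφ.smooth.continuous hφ.compactSupport
  have hpair : ∀ g : Rn n → ℝ, ContDiff ℝ ∞ g → HasCompactSupport g → ∀ w : Rn n,
      ∫ y, g y * inner ℝ w (σ y) ∂m = (∫ y, g y ∂μ) * inner ℝ w v := by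
    intro g hg hc w
    have hφ := isTestField_smul hg hc w
    have h1 := (h.gaussGreen _ hφ).symm.trans (hμ.gaussGreen _ hφ)
    simp only [real_inner_smul_left, integral_mul_const] at h1
    linarith
  set s : Rn n → ℝ := fun y => inner ℝ v (σ y) with hs
  have hsm : Measurable s := measurable_const.inner h.measurable
  -- testing against fields orthogonal to `v` shows that `σ` is parallel to `v`
  have hpar : ∀ᵐ y ∂m, σ y = s y • v := by
    have hloc : LocallyIntegrable (fun y => s y • v) m := by
      refine (locallyIntegrable_const (1 : ℝ)).mono
        (hsm.smul_const v).aestronglyMeasurable ?_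
      filter_upwards [h.norm_eq_one] with y hy
      have := abs_real_inner_le_norm v (σ y)
      rw [hv, hy, mul_one] at this
      simpa [norm_smul, hv, hs] using this
    refine ae_eq_of_integral_contDiff_smul_eq h.locallyIntegrable hloc fun g hg hc => ?_
    have hi1 : Integrable (fun y => g y • σ y) m :=
      h.locallyIntegrable.integrable_smul_left_of_hasCompactSupport hg.continuous hc
    have hi2 : Integrable (fun y => g y • s y • v) m :=
      hloc.integrable_smul_left_of_hasCompactSupport hg.continuous hc
    refine ext_inner_left ℝ fun w => ?_
    rw [← integral_inner hi1, ← integral_inner hi2]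
    simp only [real_inner_smul_right]
    rw [hpair g hg hc w]
    simp_rw [← mul_assoc, integral_mul_const]
    rw [hs, hpair g hg hc v, hvv, mul_one]
  have hs1 : ∀ᵐ y ∂m, |s y| = 1 := by
    filter_upwards [hpar, h.norm_eq_one] with y hy hy1
    rw [hy, norm_smul, hv, mul_one] at hy1
    exact hy1
  -- `s m = μ` with `s = ±1`, and so `s` is not negative
  set N : Set (Rn n) := {y | s y ≤ 0} with hN
  have hNm : MeasurableSet N := measurableSet_le hsm measurable_const
  have : IsLocallyFiniteMeasure (μ + m.restrict N) := ⟨fun y => by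
    refine ⟨Metric.ball y 1, Metric.ball_mem_nhds y one_pos, ?_⟩
    rw [Measure.add_apply]
    exact ENNReal.add_lt_top.2 ⟨measure_ball_lt_top, measure_ball_lt_top⟩⟩
  have heq : m.restrict Nᶜ = μ + m.restrict N := by
    refine measure_ext_of_integral_contDiff fun g hg hc => ?_
    have hg1 : ∀ ρ : Measure (Rn n), IsLocallyFiniteMeasure ρ → Integrable g ρ := fun ρ _ =>
      hg.continuous.integrable_of_hasCompactSupport hc
    have hi := hgi g hg hc v
    rw [integral_add_measure (hg1 _ inferInstance) (hg1 _ inferInstance)]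
    have h1 := hpair g hg hc v
    rw [hvv, mul_one, ← integral_add_compl hNm hi] at h1
    have h2 : ∫ y in N, g y * inner ℝ v (σ y) ∂m = -∫ y in N, g y ∂m := by
      rw [← integral_neg]
      refine setIntegral_congr_ae hNm ?_
      filter_upwards [hs1] with y hy hyN
      change g y * s y = _
      rw [abs_of_nonpos hyN] at hy
      rw [← neg_eq_iff_eq_neg.2 hy.symm]; ring
    have h3 : ∫ y in Nᶜ, g y * inner ℝ v (σ y) ∂m = ∫ y in Nᶜ, g y ∂m := by
      refine setIntegral_congr_ae hNm.compl ?_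
      filter_upwards [hs1] with y hy hyN
      change g y * s y = _
      rw [abs_of_pos (not_le.1 (notMem_of_mem_compl hyN))] at hy
      rw [hy, mul_one]
    linarith
  have hN0 : m N = 0 := by
    have h1 := congrArg (fun ρ : Measure (Rn n) => ρ N) heq
    simp only [Measure.add_apply, Measure.restrict_apply hNm, inter_compl_self, measure_empty,
      inter_self] at h1
    exact (add_eq_zero.1 h1.symm).2
  have hN0' : ∀ᵐ y ∂m, y ∉ N := measure_eq_zero_iff_ae_notMem.1 hN0
  filter_upwards [hpar, hs1, hN0'] with y h1 h2 h3
  rw [abs_of_pos (not_le.1 h3)] at h2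
  rw [h1, h2, one_smul]

/-- A set whose fractional gradient is a vector valued Radon measure has locally finite fractional
Caccioppoli perimeter. -/
theorem IsFracGradient.hasLocFiniteFracPerimeter {n : ℕ} {α : ℝ} {F : Set (Rn n)}
    {m : Measure (Rn n)} {σ : Rn n → Rn n} (h : IsFracGradient α F m σ)
    (hF : NullMeasurableSet F (volume : Measure (Rn n))) :
    HasLocFiniteFracPerimeter α F univ := by
  have := h.locallyFinite
  refine ⟨hF, fun U hU hUc _ => ?_⟩
  have hfin : m (closure U) ≠ ⊤ := hUc.measure_lt_top.ne
  refine lt_of_le_of_lt (iSup_le fun φ => iSup_le fun hφ => iSup_le fun hφ1 => ?_)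
    (ENNReal.ofReal_lt_top (r := m.real (closure U)))
  refine ENNReal.ofReal_le_ofReal ?_
  rw [h.gaussGreen φ ⟨hφ.smooth, hφ.compactSupport, subset_univ _⟩]
  have hi : Integrable ((closure U).indicator fun _ => (1 : ℝ)) m :=
    (integrable_indicator_iff isClosed_closure.measurableSet).2 (integrableOn_const hfin)
  refine (neg_le_abs _).trans ?_
  rw [← Real.norm_eq_abs]
  refine (norm_integral_le_of_norm_le hi ?_).trans ?_
  · filter_upwards [h.norm_eq_one] with y hy
    by_cases hyU : y ∈ closure U
    · rw [indicator_of_mem hyU]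
      refine (norm_inner_le_norm _ _).trans ?_
      rw [hy, mul_one]
      exact hφ1 y
    · rw [image_eq_zero_of_notMem_tsupport
        (fun h => hyU (subset_closure (hφ.support_subset h)))]
      simp [hyU]
  · rw [integral_indicator isClosed_closure.measurableSet]
    simp

/-! ### Fractional gradients of tangent sets -/

theorem isFracGradient_fracGradient {n : ℕ} {α : ℝ} {E : Set (Rn n)}
    (h : ∃ (m : Measure (Rn n)) (σ : Rn n → Rn n), IsFracGradient α E m σ) :
    IsFracGradient α E (fracVariation α E) (fracDensity α E) := by
  obtain ⟨m, σ, h⟩ := h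
  have h' : ∃ p : Measure (Rn n) × (Rn n → Rn n), IsFracGradient α E p.1 p.2 := ⟨(m, σ), h⟩
  rw [fracVariation, fracDensity, fracGradient, dif_pos h']
  exact h'.choose_spec

/-- A point of the support of `|D^α χ_E|` witnesses the existence of `D^α χ_E`. -/
theorem isFracGradient_of_mem_support {n : ℕ} {α : ℝ} {E : Set (Rn n)} {x : Rn n}
    (hx : x ∈ (fracVariation α E).support) :
    IsFracGradient α E (fracVariation α E) (fracDensity α E) := by
  refine isFracGradient_fracGradient ?_
  by_contra hne
  have h' : ¬∃ p : Measure (Rn n) × (Rn n → Rn n), IsFracGradient α E p.1 p.2 :=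
    fun ⟨p, hp⟩ => hne ⟨p.1, p.2, hp⟩
  rw [fracVariation, fracGradient, dif_neg h', Measure.mem_support_iff_forall] at hx
  simpa using hx univ univ_mem

theorem measureReal_ball_pos_of_mem_support {n : ℕ} {m : Measure (Rn n)} [IsLocallyFiniteMeasure m]
    {x : Rn n} (hx : x ∈ m.support) {r : ℝ} (hr : 0 < r) : 0 < m.real (Metric.ball x r) :=
  ENNReal.toReal_pos ((Measure.mem_support_iff_forall x).1 hx _ (Metric.ball_mem_nhds x hr)).ne'
    measure_ball_lt_top.ne

/-- At a point of the reduced boundary the deviation of the density from the normal is small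
compared with the mass of small balls. -/
theorem exists_setIntegral_one_sub_le {n : ℕ} {α : ℝ} {E : Set (Rn n)} {x v : Rn n}
    (hx : x ∈ (fracVariation α E).support) (hv : ‖v‖ = 1)
    (hlim : Tendsto (normalQuotient α E x) (𝓝[>] (0 : ℝ)) (𝓝 v)) {ε : ℝ} (hε : 0 < ε) :
    ∃ r₀ > 0, ∀ r, 0 < r → r ≤ r₀ →
      ∫ y in Metric.ball x r, (1 - inner ℝ v (fracDensity α E y)) ∂(fracVariation α E) ≤
        ε * (fracVariation α E).real (Metric.ball x r) := by
  have h := isFracGradient_of_mem_support hx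
  have := h.locallyFinite
  have h1 : Tendsto (fun r => 1 - inner ℝ v (normalQuotient α E x r)) (𝓝[>] (0 : ℝ)) (𝓝 0) := by
    have := ((tendsto_const_nhds (x := v)).inner (𝕜 := ℝ) hlim).const_sub 1
    rwa [real_inner_self_eq_norm_sq, hv, one_pow, sub_self] at this
  obtain ⟨r₀, hr₀, hr⟩ := mem_nhdsGT_iff_exists_Ioc_subset.1 ((tendsto_order.1 h1).2 ε hε)
  refine ⟨r₀, hr₀, fun r hr0 hr1 => ?_⟩
  have h2 : 1 - inner ℝ v (normalQuotient α E x r) < ε := hr ⟨hr0, hr1⟩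
  have hpos := measureReal_ball_pos_of_mem_support hx hr0
  rw [h.setIntegral_ball_one_sub]
  rw [normalQuotient, fracGradientValue, real_inner_smul_right] at h2
  have h3 := mul_le_mul_of_nonneg_right h2.le hpos.le
  rwa [sub_mul, one_mul, mul_right_comm, inv_mul_cancel₀ hpos.ne', one_mul] at h3

/-- If `D^α χ_F` has constant density `v`, then `v` is the normal at every point of the support. -/
theorem fracNormal_eq_of_const {n : ℕ} {α : ℝ} {F : Set (Rn n)} {v y : Rn n}
    (hF : IsFracGradient α F (fracVariation α F) (fracDensity α F))
    (hσ : ∀ᵐ z ∂(fracVariation α F), fracDensity α F z = v)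
    (hy : y ∈ (fracVariation α F).support) : fracNormal α F y = v := by
  have := hF.locallyFinite
  refine Tendsto.limUnder_eq (tendsto_const_nhds.congr' ?_)
  filter_upwards [self_mem_nhdsWithin] with r hr
  have hpos := measureReal_ball_pos_of_mem_support hy hr
  rw [normalQuotient, fracGradientValue, integral_congr_ae (ae_restrict_of_ae hσ),
    setIntegral_const, smul_smul, inv_mul_cancel₀ hpos.ne', one_smul]

/-- Every tangent set at a point of the reduced boundary with normal `v` has a fractional gradient
of constant direction `v`. -/
theorem exists_isFracGradient_const_of_mem_tan {n : ℕ} {α : ℝ} (hα0 : 0 < α) (hα1 : α < 1)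
    {E : Set (Rn n)} (hE : NullMeasurableSet E (volume : Measure (Rn n))) {x v : Rn n}
    (hx : x ∈ (fracVariation α E).support) (hv : ‖v‖ = 1)
    (hlim : Tendsto (normalQuotient α E x) (𝓝[>] (0 : ℝ)) (𝓝 v))
    {F : Set (Rn n)} (hF : F ∈ Tan E x) :
    ∃ μ : Measure (Rn n), IsFracGradient α F μ (fun _ => v) := by
  -- there is no unit vector in `ℝ⁰`
  have hn : 0 < n := by
    rcases Nat.eq_zero_or_pos n with rfl | hn
    · rw [Subsingleton.elim v 0, norm_zero] at hv
      exact absurd hv zero_ne_one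
    · exact hn
  have h := isFracGradient_of_mem_support hx
  have := h.locallyFinite
  have hdev := fun ε (hε : ε > 0) => exists_setIntegral_one_sub_le hx hv hlim hε
  obtain ⟨C, r₀, hr₀, hC⟩ := h.exists_rpow_mul_measureReal_ball_le hn hα0 hα1 x hv hdev
  obtain ⟨hFm, r, hr, hr0, hconv⟩ := hF
  have hsmall : ∀ R δ : ℝ, 0 < R → 0 < δ → ∀ᶠ k in atTop, r k * R ≤ δ := by
    intro R δ hR hδ
    filter_upwards [(tendsto_order.1 hr0).2 (δ / R) (by positivity)] with k hk
    exact ((lt_div_iff₀ hR).1 hk).le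
  have hmass : ∀ R : ℝ, 0 < R → ∀ᶠ k in atTop,
      (scaledMeasure α (fracVariation α E) x (r k)).real (Metric.ball 0 R) ≤
        (R ^ (α - n))⁻¹ * C := by
    intro R hR
    filter_upwards [hsmall R r₀ hR hr₀] with k hk
    have h1 := hC (r k * R) (mul_pos (hr k) hR) hk
    rw [Real.mul_rpow (hr k).le hR.le] at h1
    rw [scaledMeasure_real_ball _ _ _ (hr k), ← div_eq_inv_mul, le_div_iff₀ (by positivity)]
    linarith
  refine exists_isFracGradient_const_of_tendsto hn hα0 hα1 hconv
    (fun k => nullMeasurableSet_rescaled hE x (hr k)) hFm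
    (fun k => h.rescaled hn hα0 hα1 x (hr k)) hv (fun R => ?_) (fun R => ?_)
  · rcases le_or_gt R 0 with hR | hR
    · exact ⟨0, Eventually.of_forall fun k => by simp [Metric.ball_eq_empty.2 hR]⟩
    · exact ⟨_, hmass R hR⟩
  · rcases le_or_gt R 0 with hR | hR
    · simp [Metric.ball_eq_empty.2 hR]
    have hnonneg : ∀ k, 0 ≤ ∫ y in Metric.ball 0 R, (1 - inner ℝ v (fracDensity α E (x + r k • y)))
        ∂(scaledMeasure α (fracVariation α E) x (r k)) := fun k =>
      integral_nonneg_of_ae (ae_restrict_of_ae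
        ((h.rescaled hn hα0 hα1 x (hr k)).one_sub_inner_nonneg hv))
    set D := (R ^ (α - n))⁻¹ * C with hD
    have hD0 : 0 ≤ D := by
      obtain ⟨k, hk⟩ := (hmass R hR).exists
      exact measureReal_nonneg.trans hk
    rw [Metric.tendsto_nhds]
    intro ε hε
    obtain ⟨δ, hδ, hδ'⟩ := hdev (ε / (D + 1)) (by positivity)
    filter_upwards [hsmall R δ hR hδ, hmass R hR] with k h1 h2
    rw [Real.dist_eq, sub_zero, abs_of_nonneg (hnonneg k),
      setIntegral_ball_scaledMeasure _ _ _ (hr k)]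
    simp_rw [add_smul_smul_sub x (hr k)]
    have h3 := hδ' (r k * R) (mul_pos (hr k) hR) h1
    rw [scaledMeasure_real_ball _ _ _ (hr k)] at h2
    have hrk : 0 ≤ r k ^ (α - n) := Real.rpow_nonneg (hr k).le _
    set M := (fracVariation α E).real (Metric.ball x (r k * R))
    calc _ ≤ r k ^ (α - n) * (ε / (D + 1) * M) := mul_le_mul_of_nonneg_left h3 hrk
      _ = ε / (D + 1) * (r k ^ (α - n) * M) := by ring
      _ ≤ ε / (D + 1) * D := by gcongr
      _ < ε := by
        rw [div_mul_eq_mul_div, div_lt_iff₀ (by positivity)]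
        nlinarith

end FracBV

/-- The second conjunct records that `D^α χ_F` exists as a vector-valued Radon measure, with
total variation `|D^α χ_F|`, so that the last one is about the genuine measure. -/
theorem mainTheorem2 (n : ℕ) (α : ℝ) (hα0 : 0 < α) (hα1 : α < 1)
    (E : Set (FracBV.Rn n)) (hE : FracBV.HasLocFiniteFracPerimeter α E Set.univ)
    (x : FracBV.Rn n) (hx : x ∈ FracBV.fracReducedBoundary α E)
    (F : Set (FracBV.Rn n)) (hF : F ∈ FracBV.Tan E x) :
    FracBV.HasLocFiniteFracPerimeter α F Set.univ ∧
    FracBV.IsFracGradient α F (FracBV.fracVariation α F) (FracBV.fracDensity α F) ∧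
    ∀ᵐ y ∂(FracBV.fracVariation α F),
      y ∈ FracBV.fracReducedBoundary α F →
        FracBV.fracNormal α F y = FracBV.fracNormal α E x := by
  obtain ⟨hxs, v, hv, hlim⟩ := hx
  obtain ⟨μ, hμ⟩ :=
    FracBV.exists_isFracGradient_const_of_mem_tan hα0 hα1 hE.1 hxs hv hlim hF
  have hgrad := FracBV.isFracGradient_fracGradient ⟨μ, _, hμ⟩
  refine ⟨hμ.hasLocFiniteFracPerimeter hF.1, hgrad, ae_of_all _ fun y hy => ?_⟩
  rw [FracBV.fracNormal_eq_of_const hgrad (hgrad.ae_eq_of_const hv hμ) hy.1]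
  exact hlim.limUnder_eq.symm
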